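/- Let $L^2(\mathbb R)$ be the Hilbert space of complex-valued square-integrable functions on $\mathbb R$ with respect to Lebesgue measure. For $n\ge 0$ let $$H_n(x)=(-1)^n e^{x^2}\frac{d^n}{dx^n}e^{-x^2},\qquad h_n(x)=\frac{(2/\pi)^{1/4}}{\sqrt{2^n n!}}\,e^{-x^2}H_n(\sqrt2\,x)$$ be the Hermite polynomials and Hermite functions, and let $F$ be the Fourier transform $$F(f)(x)=\frac1{\sqrt\pi}\int_{\mathbb R} f(t)e^{2ixt}\,dt,$$ extended by continuity from the Schwartz functions to a unitary operator on $L^2(\mathbb R)$. For $0\le k\le 3$ let $X_k$ be the closed linear span in $L^2(\mathbb R)$ of the functions $h_{k+4m}$, $m\ge 0$, and let $P_k$ be the orthogonal projection of $L^2(\mathbb R)$ onto $X_k$. Then: 1. $L^2(\mathbb R)=\bigoplus_{k=0}^3 X_k$, an orthogonal direct sum; 2. $F=P_0+iP_1-P_2-iP_3$; 3. for each $0\le k\le 3$, $i^k$ is an eigenvalue of $F$ and $X_k$ is the corresponding eigenspace, $X_k=\{f\in L^2(\mathbb R): Ff=i^kf\}$. -/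

import Mathlib

open MeasureTheory SchwartzMap
open scoped FourierTransform ENNReal

noncomputable section

namespace HermiteFourier

/-- The complex Hilbert space `L²(ℝ) = L²(ℝ, dx)`. -/
abbrev L2R : Type := Lp (α := ℝ) ℂ 2 volume

/-! ### Hermite functions -/

/-- The `n`th Hermite polynomial, `H_n(x) = (-1)^n e^{x²} (d/dx)^n e^{-x²}`. -/
def hermiteH (n : ℕ) (x : ℝ) : ℝ :=
  (-1) ^ n * Real.exp (x ^ 2) * iteratedDeriv n (fun y : ℝ => Real.exp (-y ^ 2)) x

/-- The `n`th Hermite function,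
`h_n(x) = (2/π)^{1/4} / √(2^n n!) * e^{-x²} H_n(√2 x)`. -/
def hermiteFun (n : ℕ) (x : ℝ) : ℝ :=
  (2 / Real.pi) ^ (1 / 4 : ℝ) / Real.sqrt (2 ^ n * (n.factorial : ℝ)) *
    Real.exp (-x ^ 2) * hermiteH n (Real.sqrt 2 * x)

theorem exists_iteratedDeriv_gaussian (n : ℕ) : ∃ p : Polynomial ℝ,
    iteratedDeriv n (fun y : ℝ => Real.exp (-y ^ 2)) =
      fun y => p.eval y * Real.exp (-y ^ 2) := by
  induction n with
  | zero => exact ⟨1, by simp⟩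
  | succ n ih =>
    obtain ⟨p, hp⟩ := ih
    refine ⟨p.derivative - 2 * Polynomial.X * p, ?_⟩
    rw [iteratedDeriv_succ, hp]
    funext y
    have h1 : HasDerivAt (fun y : ℝ => Real.exp (-y ^ 2)) (Real.exp (-y ^ 2) * (-(2 * y))) y := by
      have := ((hasDerivAt_pow 2 y).neg).exp
      simpa using this
    have h2 := (p.hasDerivAt y).mul h1
    refine (HasDerivAt.deriv h2).trans ?_
    simp only [Polynomial.eval_sub, Polynomial.eval_mul, Polynomial.eval_X, Polynomial.eval_ofNat]
    ring

theorem integrable_eval_mul_gaussian (p : Polynomial ℝ) :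
    Integrable (fun x : ℝ => p.eval x * Real.exp (-2 * x ^ 2)) := by
  induction p using Polynomial.induction_on' with
  | add p q hp hq =>
    refine (hp.add hq).congr (Filter.Eventually.of_forall fun x => ?_)
    simp [add_mul]
  | monomial n a =>
    have h := (integrable_rpow_mul_exp_neg_mul_sq (b := 2) (by norm_num) (s := n)
      (by have : (0 : ℝ) ≤ n := n.cast_nonneg
          linarith)).const_mul a
    simpa [mul_assoc, Real.rpow_natCast] using h

theorem exists_hermiteFun_eq (n : ℕ) : ∃ p : Polynomial ℝ,
    ∀ x, hermiteFun n x = p.eval x * Real.exp (-x ^ 2) := by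
  obtain ⟨p, hp⟩ := exists_iteratedDeriv_gaussian n
  refine ⟨Polynomial.C ((2 / Real.pi) ^ (1 / 4 : ℝ) / Real.sqrt (2 ^ n * (n.factorial : ℝ)) *
    (-1) ^ n) * p.comp (Polynomial.C (Real.sqrt 2) * Polynomial.X), fun x => ?_⟩
  have h1 : Real.exp ((Real.sqrt 2 * x) ^ 2) * Real.exp (-(Real.sqrt 2 * x) ^ 2) = 1 := by
    rw [← Real.exp_add]; simp
  simp only [hermiteFun, hermiteH, hp, Polynomial.eval_mul, Polynomial.eval_C,
    Polynomial.eval_comp, Polynomial.eval_X]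
  linear_combination ((2 / Real.pi) ^ (1 / 4 : ℝ) / Real.sqrt (2 ^ n * (n.factorial : ℝ)) *
    (-1) ^ n * Polynomial.eval (Real.sqrt 2 * x) p * Real.exp (-x ^ 2)) * h1

theorem memLp_hermiteFun (n : ℕ) :
    MemLp (fun x : ℝ => ((hermiteFun n x : ℝ) : ℂ)) 2 volume := by
  obtain ⟨p, hp⟩ := exists_hermiteFun_eq n
  have hc : Continuous (hermiteFun n) := by
    rw [funext hp]; fun_prop
  have h2 : MemLp (hermiteFun n) 2 volume := by
    rw [memLp_two_iff_integrable_sq hc.aestronglyMeasurable]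
    refine (integrable_eval_mul_gaussian (p ^ 2)).congr (Filter.Eventually.of_forall fun x => ?_)
    have : Real.exp (-2 * x ^ 2) = Real.exp (-x ^ 2) ^ 2 := by
      rw [← Real.exp_nat_mul]; congr 1; push_cast; ring
    simp only [hp, this, Polynomial.eval_pow]
    ring
  exact h2.ofReal

/-- The `n`th Hermite function as an element of `L²(ℝ)`. -/
def hermiteL2 (n : ℕ) : L2R := (memLp_hermiteFun n).toLp

/-- `X_k`, the closed subspace of `L²(ℝ)` spanned by the Hermite functions `h_{k+4m}`, `m ≥ 0`. -/
def X (k : Fin 4) : Submodule ℂ L2R :=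
  (Submodule.span ℂ (Set.range fun m : ℕ => hermiteL2 ((k : ℕ) + 4 * m))).topologicalClosure

instance completeSpace_X (k : Fin 4) : CompleteSpace (X k) := by
  unfold X; infer_instance

/-- `P_k`, the orthogonal projection of `L²(ℝ)` onto `X_k`, as an operator on `L²(ℝ)`. -/
def P (k : Fin 4) : L2R →L[ℂ] L2R := (X k).starProjection

/-! ### The Fourier transform -/

theorem neg_inv_pi_ne_zero : -(Real.pi)⁻¹ ≠ 0 := neg_ne_zero.2 (inv_ne_zero Real.pi_ne_zero)

/-- The dilation `x ↦ -x/π` of the real line. -/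
def dilation : ℝ ≃L[ℝ] ℝ :=
  ContinuousLinearEquiv.unitsEquivAut ℝ (Units.mk0 (-(Real.pi)⁻¹) neg_inv_pi_ne_zero)

theorem dilation_apply (x : ℝ) : dilation x = -(Real.pi)⁻¹ * x := by
  simp [dilation, mul_comm]

theorem sqrt_pi_ne_zero : ((Real.sqrt Real.pi : ℝ) : ℂ) ≠ 0 := by
  exact_mod_cast (Real.sqrt_pos.2 Real.pi_pos).ne'

/-- The Fourier transform on Schwartz functions,
`f ↦ (x ↦ (1/√π) ∫ f(t) e^{2ixt} dt)`, obtained from Mathlib's Fourier transform by rescaling;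
the integral formula is `fourierSchwartz_apply`. -/
def fourierSchwartz : 𝓢(ℝ, ℂ) ≃ₗ[ℂ] 𝓢(ℝ, ℂ) where
  toFun f := ((Real.sqrt Real.pi : ℝ) : ℂ)⁻¹ •
    compCLMOfContinuousLinearEquiv ℂ dilation (𝓕 f)
  map_add' f g := by simp [FourierTransform.fourier_add]
  map_smul' c f := by
    simp only [FourierTransform.fourier_smul, map_smul, RingHom.id_apply]
    rw [smul_comm]
  invFun g := 𝓕⁻ (((Real.sqrt Real.pi : ℝ) : ℂ) •
    compCLMOfContinuousLinearEquiv ℂ dilation.symm g)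
  left_inv f := by
    simp only [map_smul]
    rw [smul_inv_smul₀ sqrt_pi_ne_zero]
    have h : compCLMOfContinuousLinearEquiv ℂ dilation.symm
        (compCLMOfContinuousLinearEquiv ℂ dilation (𝓕 f)) = 𝓕 f := by
      ext x
      simp
    rw [h, FourierTransform.fourierInv_fourier_eq]
  right_inv g := by
    simp only [FourierTransform.fourier_fourierInv_eq, map_smul]
    rw [inv_smul_smul₀ sqrt_pi_ne_zero]
    ext x
    simp

/-- The integral formula for the Fourier transform. -/
theorem fourierSchwartz_apply (f : 𝓢(ℝ, ℂ)) (x : ℝ) :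
    fourierSchwartz f x =
      1 / ((Real.sqrt Real.pi : ℝ) : ℂ) * ∫ t : ℝ, f t * Complex.exp (2 * Complex.I * x * t) := by
  have h : fourierSchwartz f x =
      ((Real.sqrt Real.pi : ℝ) : ℂ)⁻¹ * 𝓕 (f : ℝ → ℂ) (dilation x) := rfl
  rw [h, Real.fourier_real_eq_integral_exp_smul, one_div]
  congr 1
  refine integral_congr_ae (Filter.Eventually.of_forall fun t => ?_)
  have hpi : (Real.pi : ℂ) ≠ 0 := by exact_mod_cast Real.pi_ne_zero
  simp only [dilation_apply, smul_eq_mul]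
  rw [mul_comm]
  congr 2
  push_cast
  field_simp

theorem norm_toLp_two_sq (f : 𝓢(ℝ, ℂ)) : ‖f.toLp 2 volume‖ ^ 2 = ∫ x : ℝ, ‖f x‖ ^ 2 := by
  rw [norm_toLp' (by norm_num) (by norm_num)]
  have h0 : (0 : ℝ) ≤ ∫ x : ℝ, ‖f x‖ ^ 2 := integral_nonneg fun x => by positivity
  simp only [ENNReal.toReal_ofNat, Real.rpow_ofNat]
  rw [← Real.rpow_natCast, ← Real.rpow_mul h0]
  norm_num

theorem norm_fourierSchwartz (f : 𝓢(ℝ, ℂ)) :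
    ‖(fourierSchwartz f).toLp 2 volume‖ = ‖f.toLp 2 volume‖ := by
  rw [← norm_fourier_toL2_eq f, ← sq_eq_sq₀ (norm_nonneg _) (norm_nonneg _),
    norm_toLp_two_sq, norm_toLp_two_sq]
  have h : ∀ x, ‖fourierSchwartz f x‖ ^ 2 =
      (Real.pi)⁻¹ * ‖(𝓕 f) (-(Real.pi)⁻¹ * x)‖ ^ 2 := by
    intro x
    have h : fourierSchwartz f x =
      ((Real.sqrt Real.pi : ℝ) : ℂ)⁻¹ * (𝓕 f) (dilation x) := rfl
    rw [h, dilation_apply, norm_mul, mul_pow, norm_inv, Complex.norm_real, inv_pow,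
      Real.norm_eq_abs, sq_abs, Real.sq_sqrt Real.pi_pos.le]
  simp_rw [h]
  have hc := Measure.integral_comp_mul_left (fun y : ℝ => ‖(𝓕 f) y‖ ^ 2) (-(Real.pi)⁻¹)
  rw [integral_const_mul]
  refine (congrArg (fun r : ℝ => (Real.pi)⁻¹ * r) hc).trans ?_
  simp [abs_of_pos Real.pi_pos, Real.pi_ne_zero]

/-- The Fourier transform `F(f)(x) = (1/√π) ∫ f(t) e^{2ixt} dt` as a unitary operator on `L²(ℝ)`:
the unique continuous extension of the integral transform from the dense subspace of
Schwartz functions. -/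
def F : L2R ≃ₗᵢ[ℂ] L2R :=
  fourierSchwartz.extendOfIsometry
    (toLpCLM ℂ (E := ℝ) ℂ 2 volume) (toLpCLM ℂ (E := ℝ) ℂ 2 volume)
    (denseRange_toLpCLM ENNReal.ofNat_ne_top) (denseRange_toLpCLM ENNReal.ofNat_ne_top)
    norm_fourierSchwartz

/-- On Schwartz functions `F` is given by the integral formula. -/
theorem F_toLp (f : 𝓢(ℝ, ℂ)) : F (f.toLp 2 volume) = (fourierSchwartz f).toLp 2 volume :=
  LinearEquiv.extendOfIsometry_eq fourierSchwartz
    (toLpCLM ℂ (E := ℝ) ℂ 2 volume).toLinearMap (toLpCLM ℂ (E := ℝ) ℂ 2 volume).toLinearMap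
    (denseRange_toLpCLM ENNReal.ofNat_ne_top) (denseRange_toLpCLM ENNReal.ofNat_ne_top)
    norm_fourierSchwartz f

end HermiteFourier

end

open HermiteFourier

noncomputable section

namespace HermiteFourier

/-! ### The Gaussian and the ladder operator on Schwartz functions -/

/-! The operator `2x - d/dx` satisfies `F ∘ raising = i • raising ∘ F` on Schwartz functions, and
`F` fixes `e^{-x²}`. Hence `F` multiplies the `n`th iterate of `raising` on the Gaussian, a nonzero
multiple of `h_n`, by `i^n` (`F_hermiteL2`), and by continuity `F` acts on `X_k` as `i^k`.

Since `F` is unitary, eigenvectors for different powers of `i` are orthogonal, so the `X_k` are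
mutually orthogonal; orthogonality of the individual `h_n` is never needed. The analytic core is
completeness (`eq_zero_of_inner_hermiteL2`): if `f ⊥ h_n` for all `n`, then `e^{-x²} f` has zero
moments, so its Fourier transform vanishes and `f = 0`. Density then gives `∑ P_k = 1`, from which
the formula for `F` and the eigenspaces follow. -/

theorem exists_abs_eval_mul_gaussian_le (p : Polynomial ℝ) :
    ∃ C : ℝ, ∀ x, |p.eval x| * Real.exp (-x ^ 2) ≤ C := by
  induction p using Polynomial.induction_on' with
  | add p q hp hq =>
    obtain ⟨C, hC⟩ := hp
    obtain ⟨D, hD⟩ := hq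
    refine ⟨C + D, fun x => ?_⟩
    rw [Polynomial.eval_add]
    calc |p.eval x + q.eval x| * Real.exp (-x ^ 2)
        ≤ (|p.eval x| + |q.eval x|) * Real.exp (-x ^ 2) := by gcongr; exact abs_add_le _ _
      _ ≤ C + D := by rw [add_mul]; exact add_le_add (hC x) (hD x)
  | monomial n a =>
    refine ⟨|a| * (1 + n.factorial), fun x => ?_⟩
    have h1 : (x ^ 2) ^ n * Real.exp (-x ^ 2) ≤ n.factorial := by
      have h := Real.pow_div_factorial_le_exp (x ^ 2) (sq_nonneg x) n
      rw [div_le_iff₀ (by positivity)] at h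
      calc (x ^ 2) ^ n * Real.exp (-x ^ 2)
          ≤ Real.exp (x ^ 2) * n.factorial * Real.exp (-x ^ 2) := by gcongr
        _ = n.factorial := by
          rw [mul_right_comm, ← Real.exp_add]; simp
    -- Reduces all powers, odd ones included, to the even powers bounded in `h1` by a single term of
    -- the exponential series.
    have h2 : |x| ^ n ≤ 1 + (x ^ 2) ^ n := by
      rw [← sq_abs x, ← pow_mul, mul_comm 2 n, pow_mul]
      nlinarith [sq_nonneg (|x| ^ n - 1), sq_nonneg (|x| ^ n)]
    have h3 : Real.exp (-x ^ 2) ≤ 1 := Real.exp_le_one_iff.2 (by nlinarith [sq_nonneg x])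
    rw [Polynomial.eval_monomial, abs_mul, abs_pow, mul_assoc]
    gcongr
    calc |x| ^ n * Real.exp (-x ^ 2) ≤ (1 + (x ^ 2) ^ n) * Real.exp (-x ^ 2) := by gcongr
      _ ≤ 1 + n.factorial := by rw [add_mul, one_mul]; exact add_le_add h3 h1

/-- The Gaussian `e^{-x²}` as a Schwartz function. -/
def gaussianSchwartz : 𝓢(ℝ, ℂ) where
  toFun := Complex.ofRealLI ∘ fun x : ℝ => Real.exp (-x ^ 2)
  smooth' := Complex.ofRealLI.contDiff.comp (by fun_prop)
  decay' k n := by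
    obtain ⟨p, hp⟩ := exists_iteratedDeriv_gaussian n
    obtain ⟨C, hC⟩ := exists_abs_eval_mul_gaussian_le (Polynomial.X ^ k * p)
    refine ⟨C, fun x => ?_⟩
    rw [LinearIsometry.norm_iteratedFDeriv_comp_left (n := n) _ (by fun_prop) le_rfl,
      norm_iteratedFDeriv_eq_norm_iteratedDeriv, hp]
    refine le_trans (le_of_eq ?_) (hC x)
    simp [abs_mul, mul_assoc]

theorem gaussianSchwartz_apply (x : ℝ) : gaussianSchwartz x = (Real.exp (-x ^ 2) : ℂ) := by
  rfl

/-- The Gaussian integral at frequency `2x` equals `√π e^{-x²}`, and the factor `1/√π` cancels: the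
base case of the ladder. -/
theorem fourierSchwartz_gaussianSchwartz : fourierSchwartz gaussianSchwartz = gaussianSchwartz := by
  ext x
  have h := fourierIntegral_gaussian (b := 1) (by simp) (2 * x)
  rw [fourierSchwartz_apply, gaussianSchwartz_apply]
  have h2 : ∀ t : ℝ, gaussianSchwartz t * Complex.exp (2 * Complex.I * x * t) =
      Complex.exp (Complex.I * (2 * x) * t) * Complex.exp (-1 * t ^ 2) := fun t => by
    rw [gaussianSchwartz_apply, mul_comm]
    push_cast
    ring_nf
  simp_rw [h2]
  rw [h, div_one, Real.sqrt_eq_rpow, Complex.ofReal_cpow Real.pi_pos.le]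
  have h3 : (Real.pi : ℂ) ^ (1 / 2 : ℂ) ≠ 0 := by
    simp [Complex.cpow_eq_zero_iff, Real.pi_ne_zero]
  push_cast
  rw [← mul_assoc, one_div_mul_cancel h3, one_mul]
  congr 1
  ring

theorem hasTemperateGrowth_ofReal : (fun x : ℝ => (x : ℂ)).HasTemperateGrowth :=
  Complex.ofRealCLM.hasTemperateGrowth

/-- The raising operator `2x - d/dx` on Schwartz functions. -/
def raising : 𝓢(ℝ, ℂ) →L[ℂ] 𝓢(ℝ, ℂ) :=
  (2 : ℂ) • smulLeftCLM ℂ (fun x : ℝ => (x : ℂ)) - derivCLM ℂ ℂ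

theorem raising_apply (f : 𝓢(ℝ, ℂ)) (x : ℝ) :
    raising f x = 2 * x * f x - deriv f x := by
  simp [raising, smulLeftCLM_apply_apply hasTemperateGrowth_ofReal, mul_assoc]

theorem fourierSchwartz_deriv (f : 𝓢(ℝ, ℂ)) (x : ℝ) :
    fourierSchwartz (derivCLM ℂ ℂ f) x = -(2 * Complex.I * x) * fourierSchwartz f x := by
  have h (g : 𝓢(ℝ, ℂ)) : fourierSchwartz g x =
      ((Real.sqrt Real.pi : ℝ) : ℂ)⁻¹ * 𝓕 (g : ℝ → ℂ) (dilation x) := rfl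
  have h2 : (derivCLM ℂ ℂ f : ℝ → ℂ) = deriv f := by ext; simp
  have hpi : (Real.pi : ℂ) ≠ 0 := by exact_mod_cast Real.pi_ne_zero
  rw [h, h, h2, Real.fourier_deriv f.integrable f.differentiable
    (by rw [← h2]; exact (derivCLM ℂ ℂ f).integrable), dilation_apply]
  push_cast
  simp only [smul_eq_mul]
  field_simp

theorem deriv_fourierSchwartz (f : 𝓢(ℝ, ℂ)) (x : ℝ) :
    deriv (fourierSchwartz f) x =
      2 * Complex.I * fourierSchwartz (smulLeftCLM ℂ (fun x : ℝ => (x : ℂ)) f) x := by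
  have h (g : 𝓢(ℝ, ℂ)) (x : ℝ) : fourierSchwartz g x =
      ((Real.sqrt Real.pi : ℝ) : ℂ)⁻¹ * 𝓕 (g : ℝ → ℂ) (-(Real.pi)⁻¹ * x) := by
    rw [← dilation_apply]; rfl
  have hpi : (Real.pi : ℂ) ≠ 0 := by exact_mod_cast Real.pi_ne_zero
  have hint : Integrable (fun x : ℝ => x • f x) := by
    refine (smulLeftCLM ℂ (fun x : ℝ => (x : ℂ)) f).integrable.congr (.of_forall fun x => ?_)
    simp [smulLeftCLM_apply_apply hasTemperateGrowth_ofReal]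
  have hd := (Real.hasDerivAt_fourier f.integrable hint (-(Real.pi)⁻¹ * x))
  have hd2 := (hd.scomp x ((hasDerivAt_id x).const_mul (-(Real.pi)⁻¹))).const_mul
    (((Real.sqrt Real.pi : ℝ) : ℂ)⁻¹)
  have h3 : (fourierSchwartz f : ℝ → ℂ) = fun x =>
      ((Real.sqrt Real.pi : ℝ) : ℂ)⁻¹ * 𝓕 (f : ℝ → ℂ) (-(Real.pi)⁻¹ * x) := funext (h f)
  rw [h3]
  refine hd2.deriv.trans ?_
  rw [h]
  have h4 : (fun x : ℝ => (-2 * Real.pi * Complex.I * x) • f x) =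
      fun x => (-2 * Real.pi * Complex.I) • (smulLeftCLM ℂ (fun x : ℝ => (x : ℂ)) f) x := by
    ext x
    simp [smulLeftCLM_apply_apply hasTemperateGrowth_ofReal, mul_assoc]
  have h5 := DFunLike.congr_fun (FourierTransform.fourier_smul (-2 * Real.pi * Complex.I)
    (smulLeftCLM ℂ (fun x : ℝ => (x : ℂ)) f)) (-(Real.pi)⁻¹ * x)
  rw [h4]
  refine (congrArg (fun z : ℂ => ((Real.sqrt Real.pi : ℝ) : ℂ)⁻¹ * (-(Real.pi)⁻¹ * 1 : ℝ) • z)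
    h5).trans ?_
  simp only [smul_apply, fourier_coe, smul_eq_mul, Complex.real_smul]
  push_cast
  field_simp

/-- Transforming `2x f` gives `-i (Ff)'` and transforming `f'` gives `-2ix Ff`; their difference is
`i (2x - d/dx) Ff`. -/
theorem fourierSchwartz_raising (f : 𝓢(ℝ, ℂ)) :
    fourierSchwartz (raising f) = Complex.I • raising (fourierSchwartz f) := by
  ext x
  have h : raising f = (2 : ℂ) • smulLeftCLM ℂ (fun x : ℝ => (x : ℂ)) f - derivCLM ℂ ℂ f := rfl
  rw [smul_apply, raising_apply, deriv_fourierSchwartz, h, map_sub, map_smul, sub_apply, smul_apply,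
    fourierSchwartz_deriv]
  simp only [smul_eq_mul]
  linear_combination (2 * fourierSchwartz (smulLeftCLM ℂ (fun x : ℝ => (x : ℂ)) f) x) * Complex.I_sq

/-! ### Hermite functions as Schwartz functions -/

/-- The polynomials `Q_n` with `(2x - d/dx)^n e^{-x²} = Q_n(x) e^{-x²}`. -/
def ladderPoly : ℕ → Polynomial ℝ
  | 0 => 1
  | n + 1 => 4 * Polynomial.X * ladderPoly n - (ladderPoly n).derivative

theorem iterate_raising_gaussianSchwartz (n : ℕ) (x : ℝ) :
    (raising^[n] gaussianSchwartz) x = ((ladderPoly n).eval x * Real.exp (-x ^ 2) : ℝ) := by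
  induction n generalizing x with
  | zero => simp [gaussianSchwartz_apply, ladderPoly]
  | succ n ih =>
    rw [Function.iterate_succ_apply', raising_apply, funext ih]
    have h1 : HasDerivAt (fun y : ℝ => Real.exp (-y ^ 2)) (Real.exp (-x ^ 2) * (-(2 * x))) x := by
      simpa using ((hasDerivAt_pow 2 x).neg).exp
    have h2 := (((ladderPoly n).hasDerivAt x).mul h1).ofReal_comp
    rw [show deriv (fun x : ℝ => (((ladderPoly n).eval x * Real.exp (-x ^ 2) : ℝ) : ℂ)) x = _ from
      h2.deriv]
    simp only [ladderPoly, Polynomial.eval_sub, Polynomial.eval_mul, Polynomial.eval_X,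
      Polynomial.eval_ofNat]
    push_cast
    ring

/-- Exact degrees give both `h_n ≠ 0` and the spanning of all polynomials. -/
theorem degree_ladderPoly (n : ℕ) : (ladderPoly n).degree = n := by
  induction n with
  | zero => simp [ladderPoly]
  | succ n ih =>
    have h0 : ladderPoly n ≠ 0 := by rintro h; simp [h] at ih
    have h4 : (4 * Polynomial.X * ladderPoly n).degree = ((n + 1 : ℕ) : WithBot ℕ) := by
      rw [Polynomial.degree_mul, ih, show (4 : Polynomial ℝ) = Polynomial.C 4 from rfl,
        Polynomial.degree_C_mul_X (by norm_num)]
      push_cast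
      ring
    change (4 * Polynomial.X * ladderPoly n - (ladderPoly n).derivative).degree = _
    rw [Polynomial.degree_sub_eq_left_of_degree_lt, h4]
    rw [h4]
    refine (Polynomial.degree_derivative_lt h0).trans ?_
    rw [ih]
    exact_mod_cast n.lt_succ_self

/-- The recursion `p' - 2Xp` for derivatives of `e^{-y²}` becomes the ladder recursion `4XQ - Q'`
after substituting `√2 X` and scaling by `(-√2)^n`. -/
theorem iteratedDeriv_gaussian_sqrt_two_mul (n : ℕ) : ∃ p : Polynomial ℝ,
    iteratedDeriv n (fun y : ℝ => Real.exp (-y ^ 2)) = (fun y => p.eval y * Real.exp (-y ^ 2)) ∧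
    ladderPoly n = Polynomial.C ((-Real.sqrt 2) ^ n) *
      p.comp (Polynomial.C (Real.sqrt 2) * Polynomial.X) := by
  induction n with
  | zero => exact ⟨1, by simp, by simp [ladderPoly]⟩
  | succ n ih =>
    obtain ⟨p, hp, hq⟩ := ih
    refine ⟨p.derivative - 2 * Polynomial.X * p, ?_, ?_⟩
    · rw [iteratedDeriv_succ, hp]
      funext y
      have h1 : HasDerivAt (fun y : ℝ => Real.exp (-y ^ 2)) (Real.exp (-y ^ 2) * (-(2 * y))) y := by
        simpa using ((hasDerivAt_pow 2 y).neg).exp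
      refine (HasDerivAt.deriv ((p.hasDerivAt y).mul h1)).trans ?_
      simp only [Polynomial.eval_sub, Polynomial.eval_mul, Polynomial.eval_X,
        Polynomial.eval_ofNat]
      ring
    · have h2 : (Polynomial.C (Real.sqrt 2)) ^ 2 = (2 : Polynomial ℝ) := by
        rw [← Polynomial.C_pow, Real.sq_sqrt (by norm_num)]; rfl
      rw [ladderPoly, hq]
      simp only [Polynomial.derivative_mul, Polynomial.derivative_C, Polynomial.derivative_comp,
        Polynomial.derivative_X, Polynomial.sub_comp, Polynomial.mul_comp, Polynomial.X_comp,
        Polynomial.ofNat_comp, pow_succ, Polynomial.C_mul, Polynomial.C_neg]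
      linear_combination (-2 * Polynomial.X * Polynomial.C ((-Real.sqrt 2) ^ n) *
        p.comp (Polynomial.C (Real.sqrt 2) * Polynomial.X)) * h2

/-- The Hermite functions are nonzero multiples of the functions `(2x - d/dx)^n e^{-x²}`. -/
theorem exists_hermiteFun_eq_ladder (n : ℕ) : ∃ c : ℝ, c ≠ 0 ∧
    ∀ x, hermiteFun n x = c * ((ladderPoly n).eval x * Real.exp (-x ^ 2)) := by
  obtain ⟨p, hp, hq⟩ := iteratedDeriv_gaussian_sqrt_two_mul n
  have hs : Real.sqrt 2 ^ n ≠ 0 := by positivity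
  refine ⟨(2 / Real.pi) ^ (1 / 4 : ℝ) / Real.sqrt (2 ^ n * (n.factorial : ℝ)) /
    Real.sqrt 2 ^ n, by positivity, fun x => ?_⟩
  have h1 : Real.exp ((Real.sqrt 2 * x) ^ 2) * Real.exp (-(Real.sqrt 2 * x) ^ 2) = 1 := by
    rw [← Real.exp_add]; simp
  have h2 : (-Real.sqrt 2) ^ n = (-1) ^ n * Real.sqrt 2 ^ n := by rw [← mul_pow]; simp
  simp only [hermiteFun, hermiteH, hp, hq, Polynomial.eval_mul, Polynomial.eval_C,
    Polynomial.eval_comp, Polynomial.eval_X, h2]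
  generalize Real.sqrt 2 * x = y at h1 ⊢
  field_simp
  linear_combination p.eval y * h1

/-- `(2x - d/dx)^n e^{-x²}` as an element of `L²(ℝ)`. -/
def ladderL2 (n : ℕ) : L2R := (raising^[n] gaussianSchwartz).toLp 2 volume

theorem F_ladderL2 (n : ℕ) : F (ladderL2 n) = Complex.I ^ n • ladderL2 n := by
  have h : fourierSchwartz (raising^[n] gaussianSchwartz) =
      Complex.I ^ n • raising^[n] gaussianSchwartz := by
    induction n with
    | zero => simp [fourierSchwartz_gaussianSchwartz]
    | succ n ih =>
      rw [Function.iterate_succ_apply', fourierSchwartz_raising, ih, map_smul, smul_smul, pow_succ']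
  rw [ladderL2, F_toLp, h]
  exact map_smul (toLpCLM ℂ (E := ℝ) ℂ 2 volume) _ _

theorem exists_hermiteL2_eq (n : ℕ) : ∃ c : ℂ, c ≠ 0 ∧ hermiteL2 n = c • ladderL2 n := by
  obtain ⟨c, hc, h⟩ := exists_hermiteFun_eq_ladder n
  refine ⟨c, by exact_mod_cast hc, ?_⟩
  refine Lp.ext ?_
  filter_upwards [(memLp_hermiteFun n).coeFn_toLp, Lp.coeFn_smul (c : ℂ) (ladderL2 n),
    coeFn_toLp (raising^[n] gaussianSchwartz) 2 volume] with x h1 h2 h3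
  rw [hermiteL2, h1, h2, Pi.smul_apply, ladderL2, h3, iterate_raising_gaussianSchwartz, h]
  simp

theorem F_hermiteL2 (n : ℕ) : F (hermiteL2 n) = Complex.I ^ n • hermiteL2 n := by
  obtain ⟨c, -, h⟩ := exists_hermiteL2_eq n
  rw [h, map_smul, F_ladderL2, smul_comm]

theorem hermiteL2_ne_zero (n : ℕ) : hermiteL2 n ≠ 0 := by
  obtain ⟨c, hc, h⟩ := exists_hermiteL2_eq n
  rw [h]
  refine smul_ne_zero hc fun h0 => ?_
  have h1 : raising^[n] gaussianSchwartz = 0 := by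
    refine injective_toLp 2 volume (h0.trans ?_)
    exact (map_zero (toLpCLM ℂ (E := ℝ) ℂ 2 volume)).symm
  have h2 : ladderPoly n = 0 := Polynomial.funext fun x => by
    have h3 := iterate_raising_gaussianSchwartz n x
    rw [h1, zero_apply] at h3
    have h4 := Complex.ofReal_eq_zero.1 h3.symm
    simpa [(Real.exp_pos _).ne'] using h4
  have h5 := degree_ladderPoly n
  simp [h2] at h5

/-! ### Completeness -/

theorem integrable_exp_mul_of_memLp {g : ℝ → ℂ} (hg : MemLp g 2 volume) (s : ℝ) :
    Integrable (fun x : ℝ => Real.exp (|s * x|) * ‖(Real.exp (-x ^ 2) : ℂ) * g x‖) := by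
  have h1 : MemLp (fun x : ℝ => Real.exp (|s * x| - x ^ 2)) 2 volume := by
    have hc : Continuous fun x : ℝ => Real.exp (|s * x| - x ^ 2) := by fun_prop
    rw [memLp_two_iff_integrable_sq hc.aestronglyMeasurable]
    refine ((integrable_exp_neg_mul_sq (b := 1) one_pos).const_mul (Real.exp (s ^ 2))).mono'
      (hc.pow 2).aestronglyMeasurable (.of_forall fun x => ?_)
    rw [Real.norm_eq_abs, abs_of_nonneg (by positivity), ← Real.exp_nat_mul, ← Real.exp_add]
    refine Real.exp_le_exp.2 ?_
    push_cast
    rw [abs_mul]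
    -- By `2|s||x| ≤ s² + x²`, the squared weight is at most `e^{s²} e^{-x²}`.
    nlinarith [sq_nonneg (|s| - |x|), sq_abs s, sq_abs x]
  have h2 := h1.integrable_mul hg.norm
  refine h2.congr (.of_forall fun x => ?_)
  simp only [Pi.mul_apply]
  rw [norm_mul, Complex.norm_real, Real.norm_of_nonneg (Real.exp_pos _).le, sub_eq_add_neg,
    Real.exp_add]
  ring

/-- Expand the Fourier kernel in its power series: each term integrates to a multiple of a moment,
and the exponential integrability dominates the series, so sum and integral may be exchanged. -/
theorem fourier_eq_zero_of_moments {g : ℝ → ℂ} (hg : AEStronglyMeasurable g)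
    (hexp : ∀ s : ℝ, Integrable (fun x : ℝ => Real.exp (|s * x|) * ‖g x‖))
    (hmom : ∀ n : ℕ, ∫ x : ℝ, (x : ℂ) ^ n * g x = 0) : 𝓕 g = 0 := by
  ext y
  rw [Real.fourier_real_eq_integral_exp_smul]
  have h := hasSum_integral_of_dominated_convergence (μ := volume)
    (F := fun (n : ℕ) (x : ℝ) => ((-2 * Real.pi * x * y : ℝ) * Complex.I) ^ n / n.factorial * g x)
    (f := fun x : ℝ => Complex.exp ((-2 * Real.pi * x * y : ℝ) * Complex.I) • g x)
    (fun n x => |(-2 * Real.pi * y) * x| ^ n / n.factorial * ‖g x‖) ?_ ?_ ?_ ?_ ?_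
  · have h0 : ∀ n : ℕ, ∫ x : ℝ, ((-2 * Real.pi * x * y : ℝ) * Complex.I) ^ n / n.factorial * g x
        = 0 := fun n => by
      rw [← mul_zero ((-2 * Real.pi * y * Complex.I) ^ n / n.factorial), ← hmom n,
        ← integral_const_mul]
      congr 1
      ext x
      push_cast
      ring
    simp_rw [h0] at h
    exact h.unique hasSum_zero
  · intro n
    exact (Continuous.aestronglyMeasurable (by fun_prop)).mul hg
  · refine fun n => .of_forall fun x => le_of_eq ?_
    rw [norm_mul, norm_div, norm_pow, norm_mul, Complex.norm_I, mul_one, Complex.norm_real,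
      Complex.norm_natCast, Real.norm_eq_abs]
    ring_nf
  · exact .of_forall fun x => (Real.summable_pow_div_factorial _).mul_right _
  · refine (hexp (-2 * Real.pi * y)).congr (.of_forall fun x => ?_)
    simp only []
    rw [tsum_mul_right, Real.exp_eq_exp_ℝ, NormedSpace.exp_eq_tsum_div]
  · refine .of_forall fun x => ?_
    have h1 := NormedSpace.expSeries_div_hasSum_exp
      (((-2 * Real.pi * x * y : ℝ) : ℂ) * Complex.I)
    rw [← Complex.exp_eq_exp_ℂ] at h1
    exact h1.mul_right _

/-- Each test function `φ` is the transform of a Schwartz `ψ`, so the multiplication formula gives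
`∫ φ g = ∫ ψ 𝓕g = 0`. -/
theorem ae_eq_zero_of_fourier_eq_zero {g : ℝ → ℂ} (hg : Integrable g) (h : 𝓕 g = 0) :
    g =ᵐ[volume] 0 := by
  refine ae_eq_zero_of_integral_contDiff_smul_eq_zero hg.locallyIntegrable fun φ hφ hc => ?_
  have hg₁ : HasCompactSupport (Complex.ofRealCLM ∘ φ) := hc.comp_left rfl
  have hg₂ : ContDiff ℝ ((⊤ : ℕ∞) : WithTop ℕ∞) (Complex.ofRealCLM ∘ φ) :=
    Complex.ofRealCLM.contDiff.comp hφ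
  set ψ : 𝓢(ℝ, ℂ) := 𝓕⁻ (hg₁.toSchwartzMap hg₂) with hψ
  have h1 : 𝓕 ψ = hg₁.toSchwartzMap hg₂ := FourierTransform.fourier_fourierInv_eq _
  have h2 := VectorFourier.integral_fourierIntegral_smul_eq_flip (μ := volume) (ν := volume)
    (e := Real.fourierChar) (L := innerₗ ℝ) (f := ψ) (g := g) Real.continuous_fourierChar
    continuous_inner ψ.integrable hg
  have h3 : ∀ x, VectorFourier.fourierIntegral Real.fourierChar volume (innerₗ ℝ).flip g x = 0 :=
    fun x => by
      rw [flip_innerₗ]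
      exact congrFun h x
  simp only [h3, smul_zero, integral_zero] at h2
  rw [← h2]
  congr 1
  ext x
  have h4 : VectorFourier.fourierIntegral Real.fourierChar volume (innerₗ ℝ) ψ x = φ x :=
    DFunLike.congr_fun h1 x
  rw [h4]
  simp

theorem span_range_ladderPoly : Submodule.span ℝ (Set.range ladderPoly) = ⊤ :=
  Polynomial.Sequence.span ⟨ladderPoly, degree_ladderPoly⟩ fun i => by
    refine isUnit_iff_ne_zero.2 (Polynomial.leadingCoeff_ne_zero.2 fun h => ?_)
    have h5 := degree_ladderPoly i
    have h6 : ladderPoly i = 0 := h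
    simp [h6] at h5

theorem eq_zero_of_inner_hermiteL2 (f : L2R) (hf : ∀ n, inner ℂ (hermiteL2 n) f = 0) : f = 0 := by
  set g : ℝ → ℂ := fun x => (Real.exp (-x ^ 2) : ℂ) * f x with hgdef
  have hexp (s : ℝ) : Integrable (fun x : ℝ => Real.exp (|s * x|) * ‖g x‖) :=
    integrable_exp_mul_of_memLp (Lp.memLp f) s
  have hgm : AEStronglyMeasurable g :=
    (Continuous.aestronglyMeasurable (by fun_prop)).mul (Lp.memLp f).1
  have hgi : Integrable g := by
    rw [← integrable_norm_iff hgm]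
    simpa using hexp 0
  have hpow (n : ℕ) : Integrable fun x : ℝ => (x : ℂ) ^ n * g x := by
    refine ((hexp 1).const_mul n.factorial).mono'
      ((Continuous.aestronglyMeasurable (by fun_prop)).mul hgm) (.of_forall fun x => ?_)
    -- `|x|^n ≤ n! e^{|x|}`, so `hexp` at `s = 1` controls every moment.
    have h := Real.pow_div_factorial_le_exp |x| (abs_nonneg x) n
    rw [div_le_iff₀ (by positivity)] at h
    rw [norm_mul, norm_pow, Complex.norm_real, Real.norm_eq_abs, one_mul, ← mul_assoc,
      mul_comm (n.factorial : ℝ)]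
    gcongr
  have hpoly (p : Polynomial ℝ) : Integrable fun x : ℝ => ((p.eval x : ℝ) : ℂ) * g x := by
    induction p using Polynomial.induction_on' with
    | add p q hp hq =>
      refine (hp.add hq).congr (.of_forall fun x => ?_)
      simp [add_mul]
    | monomial n a =>
      refine ((hpow n).const_mul (a : ℂ)).congr (.of_forall fun x => ?_)
      simp [mul_assoc]
  have hzero (p : Polynomial ℝ) : ∫ x : ℝ, ((p.eval x : ℝ) : ℂ) * g x = 0 := by
    have hp : p ∈ Submodule.span ℝ (Set.range ladderPoly) := by
      rw [span_range_ladderPoly]; trivial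
    induction hp using Submodule.span_induction with
    | zero => simp
    | add p q _ _ hp hq =>
      simp only [Polynomial.eval_add, Complex.ofReal_add, add_mul]
      rw [integral_add (hpoly p) (hpoly q), hp, hq, add_zero]
    | smul a p _ hp =>
      simp only [Polynomial.eval_smul, smul_eq_mul, Complex.ofReal_mul, mul_assoc]
      rw [integral_const_mul, hp, mul_zero]
    | mem p hp =>
      obtain ⟨n, rfl⟩ := hp
      obtain ⟨c, hc, h⟩ := exists_hermiteL2_eq n
      have h1 : inner ℂ (ladderL2 n) f = 0 := by
        have := hf n
        rw [h, inner_smul_left] at this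
        simpa [hc] using this
      rw [L2.inner_def] at h1
      rw [← h1]
      refine integral_congr_ae ?_
      filter_upwards [coeFn_toLp (raising^[n] gaussianSchwartz) 2 volume] with x hx
      rw [ladderL2, hx, iterate_raising_gaussianSchwartz, hgdef]
      -- The ladder function is real, so the conjugation in the inner product disappears.
      rw [RCLike.inner_apply, Complex.conj_ofReal, Complex.ofReal_mul]
      ring
  have hmom (n : ℕ) : ∫ x : ℝ, (x : ℂ) ^ n * g x = 0 := by
    simpa using hzero (Polynomial.X ^ n)
  have hg0 := ae_eq_zero_of_fourier_eq_zero hgi (fourier_eq_zero_of_moments hgm hexp hmom)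
  refine Lp.ext ?_
  filter_upwards [hg0, Lp.coeFn_zero ℂ 2 (volume : Measure ℝ)] with x hx h0
  rw [h0]
  simpa [hgdef, Complex.exp_ne_zero] using hx

theorem topologicalClosure_span_hermiteL2 :
    (Submodule.span ℂ (Set.range hermiteL2)).topologicalClosure = ⊤ := by
  rw [Submodule.topologicalClosure_eq_top_iff, Submodule.eq_bot_iff]
  intro f hf
  exact eq_zero_of_inner_hermiteL2 f fun n =>
    (Submodule.mem_orthogonal _ _).1 hf _ (Submodule.subset_span ⟨n, rfl⟩)

/-! ### The eigenspaces of `F` -/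

theorem mem_X_hermiteL2 (k : Fin 4) (m : ℕ) : hermiteL2 ((k : ℕ) + 4 * m) ∈ X k :=
  Submodule.le_topologicalClosure _ (Submodule.subset_span ⟨m, rfl⟩)

theorem F_eq_of_mem_X {k : Fin 4} {f : L2R} (hf : f ∈ X k) : F f = Complex.I ^ (k : ℕ) • f := by
  have hcl : IsClosed {f : L2R | F f = Complex.I ^ (k : ℕ) • f} :=
    isClosed_eq F.continuous (continuous_const_smul _)
  refine closure_minimal (fun g hg => ?_) hcl hf
  induction hg using Submodule.span_induction with
  | zero => simp
  | add x y _ _ hx hy =>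
    simp only [Set.mem_ofPred_eq] at hx hy ⊢
    rw [map_add, hx, hy, smul_add]
  | smul a x _ hx =>
    simp only [Set.mem_ofPred_eq] at hx ⊢
    rw [map_smul, hx, smul_comm]
  | mem x hx =>
    obtain ⟨m, rfl⟩ := hx
    simp only [Set.mem_ofPred_eq]
    rw [F_hermiteL2, pow_add, pow_mul, Complex.I_pow_four, one_pow, mul_one]

theorem conj_I_pow_mul_I_pow_ne_one {j k : Fin 4} (hjk : j ≠ k) :
    (starRingEnd ℂ) (Complex.I ^ (j : ℕ)) * Complex.I ^ (k : ℕ) ≠ 1 := by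
  fin_cases j <;> fin_cases k <;> first
    | exact absurd rfl hjk
    | norm_num [Complex.ext_iff, pow_succ]

/-- Unitarity gives `⟪f, g⟫ = conj(i^j) i^k ⟪f, g⟫`, with a factor different from `1`. -/
theorem inner_eq_zero_of_F_eq {j k : Fin 4} (hjk : j ≠ k) {f g : L2R}
    (hf : F f = Complex.I ^ (j : ℕ) • f) (hg : F g = Complex.I ^ (k : ℕ) • g) :
    inner ℂ f g = 0 := by
  have h := F.inner_map_map f g
  rw [hf, hg, inner_smul_left, inner_smul_right, ← mul_assoc] at h
  by_contra h0
  exact conj_I_pow_mul_I_pow_ne_one hjk (mul_right_cancel₀ h0 (h.trans (one_mul _).symm))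

theorem orthogonalFamily_X :
    OrthogonalFamily ℂ (fun k : Fin 4 => X k) (fun k => (X k).subtypeₗᵢ) :=
  fun _ _ hjk f g => inner_eq_zero_of_F_eq hjk (F_eq_of_mem_X f.2) (F_eq_of_mem_X g.2)

theorem P_mem_X (k : Fin 4) (f : L2R) : P k f ∈ X k :=
  Submodule.starProjection_apply_mem _ _

theorem P_eq_self {k : Fin 4} {f : L2R} (hf : f ∈ X k) : P k f = f :=
  Submodule.starProjection_eq_self_iff.2 hf

theorem P_eq_zero_of_F_eq {j k : Fin 4} (hjk : j ≠ k) {f : L2R}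
    (hf : F f = Complex.I ^ (k : ℕ) • f) : P j f = 0 :=
  (Submodule.starProjection_apply_eq_zero_iff (X j)).2 <|
    (Submodule.mem_orthogonal _ _).2 fun _ hg => inner_eq_zero_of_F_eq hjk (F_eq_of_mem_X hg) hf

theorem sum_P_apply_of_mem_X {k : Fin 4} {f : L2R} (hf : f ∈ X k) : ∑ j, P j f = f := by
  rw [Finset.sum_eq_single k (fun j _ hj => P_eq_zero_of_F_eq hj (F_eq_of_mem_X hf)) (by simp),
    P_eq_self hf]

/-- The identity is a closed linear condition, so completeness reduces it to a single `h_n`, which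
lies in `X_k` with `k = n % 4`. -/
theorem sum_P_apply (f : L2R) : ∑ k, P k f = f := by
  have hcl : IsClosed {f : L2R | ∑ k, P k f = f} :=
    isClosed_eq (continuous_finsetSum _ fun k _ => (P k).continuous) continuous_id
  have hf : f ∈ (Submodule.span ℂ (Set.range hermiteL2)).topologicalClosure := by
    rw [topologicalClosure_span_hermiteL2]; trivial
  refine closure_minimal (fun g hg => ?_) hcl hf
  induction hg using Submodule.span_induction with
  | zero => simp
  | add x y _ _ hx hy =>
    simp only [Set.mem_ofPred_eq] at hx hy ⊢
    simp only [map_add, Finset.sum_add_distrib, hx, hy]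
  | smul a x _ hx =>
    simp only [Set.mem_ofPred_eq] at hx ⊢
    simp only [map_smul, ← Finset.smul_sum, hx]
  | mem x hx =>
    obtain ⟨n, rfl⟩ := hx
    have h := mem_X_hermiteL2 ⟨n % 4, Nat.mod_lt _ (by norm_num)⟩ (n / 4)
    rw [Nat.mod_add_div] at h
    exact sum_P_apply_of_mem_X h

theorem isInternal_X : DirectSum.IsInternal X := by
  refine DirectSum.isInternal_submodule_of_iSupIndep_of_iSup_eq_top
    orthogonalFamily_X.independent (eq_top_iff.2 fun f _ => ?_)
  rw [← sum_P_apply f]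
  exact Submodule.sum_mem _ fun k _ => Submodule.mem_iSup_of_mem k (P_mem_X k f)

/-- For the converse, an eigenvector for `i^k` is orthogonal to every other `X_j`, so only `P k f`
survives in `∑ P_j f = f`. -/
theorem mem_X_iff {k : Fin 4} {f : L2R} : f ∈ X k ↔ F f = Complex.I ^ (k : ℕ) • f := by
  refine ⟨F_eq_of_mem_X, fun hf => ?_⟩
  have h := sum_P_apply f
  rw [Finset.sum_eq_single k (fun j _ hj => P_eq_zero_of_F_eq hj hf) (by simp)] at h
  rw [← h]
  exact P_mem_X k f

theorem F_eq_sum_P :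
    (F : L2R →L[ℂ] L2R) = P 0 + Complex.I • P 1 - P 2 - Complex.I • P 3 := by
  ext1 f
  have h : F f = ∑ k : Fin 4, Complex.I ^ (k : ℕ) • P k f := by
    conv_lhs => rw [← sum_P_apply f, map_sum]
    exact Finset.sum_congr rfl fun k _ => F_eq_of_mem_X (P_mem_X k f)
  refine h.trans ?_
  simp [Fin.sum_univ_four, Complex.I_pow_three, sub_eq_add_neg]

theorem eigenspace_F (k : Fin 4) :
    Module.End.eigenspace (F : L2R →ₗ[ℂ] L2R) (Complex.I ^ (k : ℕ)) = X k := by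
  ext f
  rw [Module.End.mem_eigenspace_iff, mem_X_iff]
  rfl

end HermiteFourier
end

theorem corollary6 :
    -- `L²(ℝ)` is the orthogonal direct sum of `X_0, X_1, X_2, X_3`
    OrthogonalFamily ℂ (fun k : Fin 4 => X k) (fun k => (X k).subtypeₗᵢ) ∧
    DirectSum.IsInternal X ∧
    -- `F = P_0 + i P_1 - P_2 - i P_3`
    (F : L2R →L[ℂ] L2R) = P 0 + Complex.I • P 1 - P 2 - Complex.I • P 3 ∧
    -- `i ^ k` is an eigenvalue of `F`, with eigenspace `X_k`
    ∀ k : Fin 4,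
      Module.End.HasEigenvalue (F : L2R →ₗ[ℂ] L2R) (Complex.I ^ (k : ℕ)) ∧
      Module.End.eigenspace (F : L2R →ₗ[ℂ] L2R) (Complex.I ^ (k : ℕ)) = X k := by
  refine ⟨orthogonalFamily_X, isInternal_X, F_eq_sum_P, fun k => ⟨?_, eigenspace_F k⟩⟩
  refine Module.End.hasEigenvalue_of_hasEigenvector (x := hermiteL2 k) ⟨?_, hermiteL2_ne_zero k⟩
  change hermiteL2 k ∈ Module.End.eigenspace (F : L2R →ₗ[ℂ] L2R) (Complex.I ^ (k : ℕ))
  rw [eigenspace_F]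
  simpa using mem_X_hermiteL2 k 0
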